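/- Let $\mathbb{K}=\mathbb{R}$ or $\mathbb{C}$ and let $(X,\tau)$ be a bornological locally convex Hausdorff space over $\mathbb{K}$. For a locally convex Hausdorff space $Y$ let $Y_b'$ denote its dual with the topology of uniform convergence on bounded sets. For a locally convex Hausdorff topology $\widetilde\tau$ on $X$ we say that $(X,\tau)$ satisfies - (BBC) for $\widetilde\tau$ if every $\tau$-bounded set is contained in an absolutely convex $\tau$-bounded $\widetilde\tau$-compact set; - (BBCl) for $\widetilde\tau$ if every $\tau$-bounded set is contained in an absolutely convex $\tau$-bounded $\widetilde\tau$-closed set; - (CNC) for $\widetilde\tau$ if $\tau$ has a $0$-neighbourhood basis of absolutely convex $\widetilde\tau$-closed sets. Let $\widetilde\gamma=\widetilde\gamma(\tau,\widetilde\tau)$ be the finest locally convex Hausdorff topology on $X$ which coincides with $\widetilde\tau$ on $\tau$-bounded sets. We say that $(X,\widetilde\gamma)$ satisfies $(\mathrm{B}\tau\mathrm{B}\widetilde\gamma)$ if a subset of $X$ is $\tau$-bounded if and only if it is $\widetilde\gamma$-bounded. A locally convex Hausdorff space is semi-Montel if its bounded subsets are relatively compact, and it is semi-reflexive if the evaluation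 map into the dual of its strong dual is surjective. Then the following assertions are equivalent: (a) $(X,\tau)$ has a complete barrelled predual, i.e. there are a complete barrelled locally convex Hausdorff space $Y$ and a topological isomorphism $\varphi\colon(X,\tau)\to Y_b'$. (b) $(X,\tau)$ has a semi-Montel prebidual $(Y,\varphi)$ such that $Y_b'$ is complete, i.e. there are a semi-Montel locally convex Hausdorff space $Y$ with $Y_b'$ complete and a topological isomorphism $\varphi\colon(X,\tau)\to(Y_b')_b'$. (c) There is a locally convex Hausdorff topology $\widetilde\tau$ on $X$ such that $(X,\tau)$ satisfies (BBC) and (CNC) for $\widetilde\tau$ and $(X,\widetilde\gamma)$ satisfies $(\mathrm{B}\tau\mathrm{B}\widetilde\gamma)$. (d) There is a locally convex Hausdorff topology $\widetilde\tau$ on $X$ such that $(X,\tau)$ satisfies (BBCl) and (CNC) for $\widetilde\tau$ and $(X,\widetilde\gamma)$ is semi-reflexive and satisfies $(\mathrm{B}\tau\mathrm{B}\widetilde\gamma)$. (e) There is a locally convex Hausdorff topology $\widetilde\tau$ on $X$ such that $(X,\tau)$ satisfies (BBC) and (CNC) for $\widetilde\tau$. -/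

import Mathlib

open Set Filter Topology Bornology
open scoped ComplexOrder

universe u

/-- `t` is a locally convex Hausdorff (vector space) topology on the `𝕜`-vector space `E`. -/
structure IsLCHausdorff (𝕜 : Type) [RCLike 𝕜] {E : Type u} [AddCommGroup E] [Module 𝕜 E]
    (t : TopologicalSpace E) : Prop where
  isTopologicalAddGroup : @IsTopologicalAddGroup E t _
  continuousSMul : @ContinuousSMul 𝕜 E _ _ t
  locallyConvexSpace : @LocallyConvexSpace 𝕜 E _ _ _ _ t
  t2Space : @T2Space E t

/-- `B` is bounded (in the sense of von Neumann) with respect to the topology `t`. -/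
abbrev BoundedIn (𝕜 : Type) [RCLike 𝕜] {E : Type u} [AddCommGroup E] [Module 𝕜 E]
    (t : TopologicalSpace E) (B : Set E) : Prop :=
  @IsVonNBounded 𝕜 E _ _ _ t B

/-- A locally convex space is bornological if every absolutely convex set that absorbs all bounded
sets is a `0`-neighbourhood. -/
def IsBornological (𝕜 : Type) [RCLike 𝕜] (E : Type u) [AddCommGroup E] [Module 𝕜 E]
    [TopologicalSpace E] : Prop :=
  ∀ U : Set E, AbsConvex 𝕜 U → (∀ B : Set E, IsVonNBounded 𝕜 B → Absorbs 𝕜 U B) → U ∈ 𝓝 (0 : E)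

/-- Completeness of a topological vector space, with respect to the uniform structure given by its
additive group structure: every Cauchy filter converges. -/
def IsCompleteTVS (E : Type u) [AddCommGroup E] [TopologicalSpace E] [IsTopologicalAddGroup E] :
    Prop :=
  @CompleteSpace E (IsTopologicalAddGroup.rightUniformSpace E)

/-- Semi-reflexivity of `(E, t)`: the evaluation map from `E` into the dual of the strong dual of
`(E, t)` is surjective. (`StrongDual` carries the topology of uniform convergence on bounded
sets.) -/
def IsSemiReflexive (𝕜 : Type) [RCLike 𝕜] {E : Type u} [AddCommGroup E] [Module 𝕜 E]
    (t : TopologicalSpace E) : Prop :=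
  ∀ φ : StrongDual 𝕜 (StrongDual 𝕜 E), ∃ x : E, ∀ f : StrongDual 𝕜 E, φ f = f x

/-- `(E, τ)` satisfies (BBC) for `τ'`. -/
def BBC (𝕜 : Type) [RCLike 𝕜] {E : Type u} [AddCommGroup E] [Module 𝕜 E]
    (τ τ' : TopologicalSpace E) : Prop :=
  ∀ B : Set E, BoundedIn 𝕜 τ B →
    ∃ C : Set E, B ⊆ C ∧ AbsConvex 𝕜 C ∧ BoundedIn 𝕜 τ C ∧ @IsCompact E τ' C

/-- `(E, τ)` satisfies (BBCl) for `τ'`. -/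
def BBCl (𝕜 : Type) [RCLike 𝕜] {E : Type u} [AddCommGroup E] [Module 𝕜 E]
    (τ τ' : TopologicalSpace E) : Prop :=
  ∀ B : Set E, BoundedIn 𝕜 τ B →
    ∃ C : Set E, B ⊆ C ∧ AbsConvex 𝕜 C ∧ BoundedIn 𝕜 τ C ∧ IsClosed[τ'] C

/-- `(E, τ)` satisfies (CNC) for `τ'`. -/
def CNC (𝕜 : Type) [RCLike 𝕜] {E : Type u} [AddCommGroup E] [Module 𝕜 E]
    (τ τ' : TopologicalSpace E) : Prop :=
  ∃ 𝒰 : Set (Set E), (@nhds E τ 0).HasBasis (fun U => U ∈ 𝒰) id ∧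
    ∀ U ∈ 𝒰, AbsConvex 𝕜 U ∧ IsClosed[τ'] U

/-- The locally convex Hausdorff topologies on `E` that coincide with `τ'` on every `τ`-bounded
set. -/
def agreeingTopologies (𝕜 : Type) [RCLike 𝕜] {E : Type u} [AddCommGroup E] [Module 𝕜 E]
    (τ τ' : TopologicalSpace E) : Set (TopologicalSpace E) :=
  {σ | IsLCHausdorff 𝕜 σ ∧ ∀ B : Set E, BoundedIn 𝕜 τ B →
    σ.induced (Subtype.val : B → E) = τ'.induced (Subtype.val : B → E)}

/-- The topology `γ̃(τ, τ')`, the finest locally convex Hausdorff topology on `E` that coincides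
with `τ'` on `τ`-bounded sets (finer topologies are smaller in Mathlib's order). That it is such a
topology is `isLeast_gammaTilde`. -/
abbrev gammaTilde (𝕜 : Type) [RCLike 𝕜] {E : Type u} [AddCommGroup E] [Module 𝕜 E]
    (τ τ' : TopologicalSpace E) : TopologicalSpace E :=
  sInf (agreeingTopologies 𝕜 τ τ')

theorem isLeast_gammaTilde {𝕜 : Type} [RCLike 𝕜] {E : Type u} [AddCommGroup E] [Module 𝕜 E]
    {τ τ' : TopologicalSpace E} (h' : IsLCHausdorff 𝕜 τ') :
    IsLeast (agreeingTopologies 𝕜 τ τ') (gammaTilde 𝕜 τ τ') := by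
  have hmem : τ' ∈ agreeingTopologies 𝕜 τ τ' := ⟨h', fun _ _ => rfl⟩
  refine ⟨⟨⟨?_, ?_, ?_, ?_⟩, ?_⟩, fun σ hσ => sInf_le hσ⟩
  · exact topologicalAddGroup_sInf fun σ hσ => hσ.1.isTopologicalAddGroup
  · exact continuousSMul_sInf fun σ hσ => hσ.1.continuousSMul
  · exact LocallyConvexSpace.sInf fun σ hσ => hσ.1.locallyConvexSpace
  · exact t2Space_antitone (sInf_le hmem) h'.t2Space
  · intro B hB
    rw [gammaTilde, sInf_eq_iInf', induced_iInf]
    have : Nonempty (agreeingTopologies 𝕜 τ τ') := ⟨⟨τ', hmem⟩⟩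
    have heq : ∀ σ : agreeingTopologies 𝕜 τ τ',
        (σ : TopologicalSpace E).induced (Subtype.val : B → E) = τ'.induced Subtype.val :=
      fun σ => σ.2.2 B hB
    simp only [heq, iInf_const]

/-- A topology `γ` on `(E, τ)` satisfies (BτBγ): the `τ`-bounded and the `γ`-bounded subsets
of `E` are the same. -/
def SameBounded (𝕜 : Type) [RCLike 𝕜] {E : Type u} [AddCommGroup E] [Module 𝕜 E]
    (τ γ : TopologicalSpace E) : Prop :=
  ∀ B : Set E, BoundedIn 𝕜 τ B ↔ BoundedIn 𝕜 γ B

/-- `E` has a complete barrelled predual: a complete barrelled locally convex Hausdorff space `Y`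
with a topological isomorphism from `E` onto the strong dual of `Y`. -/
def HasCompleteBarrelledPredual (𝕜 : Type) [RCLike 𝕜] (E : Type u) [AddCommGroup E] [Module 𝕜 E]
    [TopologicalSpace E] : Prop :=
  ∃ (Y : Type u) (_ : AddCommGroup Y) (_ : Module 𝕜 Y) (_ : TopologicalSpace Y)
    (_ : IsTopologicalAddGroup Y) (_ : ContinuousSMul 𝕜 Y) (_ : LocallyConvexSpace 𝕜 Y)
    (_ : T2Space Y),
    IsCompleteTVS Y ∧ BarrelledSpace 𝕜 Y ∧ Nonempty (E ≃L[𝕜] StrongDual 𝕜 Y)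

/-- `E` has a semi-Montel prebidual with complete strong dual: a locally convex Hausdorff space `Y`
whose closed bounded subsets are compact (this is what `MontelSpace` says, without barrelledness),
with complete strong dual, and a topological isomorphism from `E` onto the strong bidual of `Y`. -/
def HasSemiMontelPrebidual (𝕜 : Type) [RCLike 𝕜] (E : Type u) [AddCommGroup E] [Module 𝕜 E]
    [TopologicalSpace E] : Prop :=
  ∃ (Y : Type u) (_ : AddCommGroup Y) (_ : Module 𝕜 Y) (_ : TopologicalSpace Y)
    (_ : IsTopologicalAddGroup Y) (_ : ContinuousSMul 𝕜 Y) (_ : LocallyConvexSpace 𝕜 Y)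
    (_ : T2Space Y),
    MontelSpace 𝕜 Y ∧ IsCompleteTVS (StrongDual 𝕜 Y) ∧
      Nonempty (E ≃L[𝕜] StrongDual 𝕜 (StrongDual 𝕜 Y))

/-! Given a barrelled predual `Y`, take for `τ'` the topology of pointwise convergence on `Y`.
Bounded sets of functionals are equicontinuous, so they lie in polars of `0`-neighbourhoods, which
are compact by Banach–Alaoglu. Basic neighbourhoods in the dual are polars of bounded sets, hence
`τ'`-closed. This gives (e).

Conversely, the prebidual is `X` itself with `γ = gammaTilde`. Since `γ` is the finest topology of
its kind, linear functionals that are `γ`-continuous on `τ`-bounded sets are `γ`-continuous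
(`continuous_gammaTilde_of_continuousOn`), so the strong dual is complete once the bounded sets
agree. (BBC) makes `γ` semi-Montel and semi-reflexive, so the bidual is `X` as a vector space; (CNC)
and bornologicality match the topologies (`nonempty_equiv_bidual`).

The delicate point is that `γ`-bounded sets are `τ`-bounded. This is a Banach–Mackey argument
(`AbsConvex.absorbs_of_weakly_bounded`): `ℓ¹`-combinations of functionals in the polar of a closed
neighbourhood stay continuous, so the uniform boundedness principle on `ℓ¹` applies. The same
argument makes the complete strong dual of a semi-reflexive space barrelled
(`barrelledSpace_strongDual`), which turns a prebidual into a predual. For (d), the weak topology of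
`γ` serves as the new `τ'`. -/

open scoped Pointwise

/-! ### Absorption and absolutely convex sets -/

section Absorbs

variable {𝕜 : Type} [RCLike 𝕜] {E : Type u} [AddCommGroup E] [Module 𝕜 E]

theorem Absorbs.exists_pos_forall_inv_smul_mem {U S : Set E} (h : Absorbs 𝕜 U S) :
    ∃ r : ℝ, 0 < r ∧ ∀ x ∈ S, ((r : 𝕜)⁻¹) • x ∈ U := by
  rw [absorbs_iff_eventually_cobounded_mapsTo] at h
  have h1 : Tendsto (fun r : ℝ => (r : 𝕜)) atTop (cobounded 𝕜) := by
    rw [← tendsto_norm_atTop_iff_cobounded]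
    simpa using tendsto_abs_atTop_atTop
  obtain ⟨r, hr, hr0⟩ := ((h1.eventually h).and (eventually_gt_atTop 0)).exists
  exact ⟨r, hr0, fun x hx => hr hx⟩

theorem Balanced.absorbs_of_forall_inv_smul_mem {U S : Set E} (hU : Balanced 𝕜 U) {r : ℝ}
    (hr : 0 < r) (h : ∀ x ∈ S, ((r : 𝕜)⁻¹) • x ∈ U) : Absorbs 𝕜 U S := by
  have hr' : (r : 𝕜) ≠ 0 := by exact_mod_cast hr.ne'
  rw [absorbs_iff_eventually_cobounded_mapsTo]
  filter_upwards [(hasBasis_cobounded_norm (E := 𝕜)).mem_of_mem (i := r) trivial] with c hc x hx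
  have hc0 : c ≠ 0 := by
    rintro rfl
    simp at hc
    linarith
  have := hU.smul_mem (a := c⁻¹ * r) (by
    rw [norm_mul, norm_inv, RCLike.norm_ofReal, abs_of_pos hr, inv_mul_le_one₀ (by positivity)]
    exact hc) (h x hx)
  rwa [smul_smul, mul_assoc, mul_inv_cancel₀ hr', mul_one] at this

theorem AbsConvex.zero_mem_of_nonempty {U : Set E} (hU : AbsConvex 𝕜 U) (h : U.Nonempty) :
    (0 : E) ∈ U := by
  obtain ⟨x, hx⟩ := h
  simpa using hU.1.smul_mem (a := (0 : 𝕜)) (by simp) hx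

theorem absConvex_setOf_forall_norm_le {ι : Type*} (s : Set ι) (J : ι → E →ₗ[𝕜] 𝕜) :
    AbsConvex 𝕜 {x : E | ∀ i ∈ s, ‖J i x‖ ≤ 1} := by
  constructor
  · rw [balanced_iff_smul_mem]
    intro a ha x hx i hi
    rw [map_smul, norm_smul]
    exact mul_le_one₀ ha (norm_nonneg _) (hx i hi)
  · intro x hx y hy a b ha hb hab i hi
    obtain ⟨a, ha', rfl⟩ := RCLike.nonneg_iff_exists_ofReal.1 ha
    obtain ⟨b, hb', rfl⟩ := RCLike.nonneg_iff_exists_ofReal.1 hb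
    have hab' : a + b = 1 := by exact_mod_cast hab
    rw [map_add, map_smul, map_smul]
    calc ‖(a : 𝕜) • J i x + (b : 𝕜) • J i y‖ ≤ a * ‖J i x‖ + b * ‖J i y‖ :=
          (norm_add_le _ _).trans (by rw [norm_smul, norm_smul, RCLike.norm_of_nonneg ha',
            RCLike.norm_of_nonneg hb'])
      _ ≤ a * 1 + b * 1 := by gcongr; exacts [hx i hi, hy i hi]
      _ = 1 := by rw [mul_one, mul_one, hab']

theorem AbsConvex.image {F : Type*} [AddCommGroup F] [Module 𝕜 F] {U : Set E}
    (hU : AbsConvex 𝕜 U) (f : E →ₗ[𝕜] F) : AbsConvex 𝕜 (f '' U) := by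
  refine ⟨?_, hU.2.linear_image f⟩
  rw [balanced_iff_smul_mem]
  rintro a ha _ ⟨x, hx, rfl⟩
  exact ⟨a • x, hU.1.smul_mem ha hx, map_smul f a x⟩

instance RCLike.instLocallyConvexSpaceSelf : LocallyConvexSpace 𝕜 𝕜 :=
  .ofBasisZero 𝕜 𝕜 _ _ Metric.nhds_basis_ball fun _ _ =>
    convex_RCLike_iff_convex_real.2 (convex_ball _ _)

end Absorbs

/-! ### Separation by continuous functionals -/

section Bipolar

variable {𝕜 : Type} [RCLike 𝕜] {E : Type u} [AddCommGroup E] [Module 𝕜 E] [TopologicalSpace E]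

theorem Bornology.IsVonNBounded.exists_norm_le {B : Set E} (hB : IsVonNBounded 𝕜 B)
    (f : StrongDual 𝕜 E) : ∃ r : ℝ, 0 < r ∧ ∀ x ∈ B, ‖f x‖ ≤ r := by
  have h1 : f ⁻¹' Metric.closedBall 0 1 ∈ 𝓝 (0 : E) :=
    f.continuous.continuousAt.preimage_mem_nhds (by
      rw [map_zero]; exact Metric.closedBall_mem_nhds _ one_pos)
  obtain ⟨r, hr, h⟩ := (hB h1).exists_pos_forall_inv_smul_mem
  refine ⟨r, hr, fun x hx => ?_⟩
  have := h x hx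
  rwa [mem_preimage, map_smul, mem_closedBall_zero_iff, norm_smul, norm_inv, RCLike.norm_ofReal,
    abs_of_pos hr, inv_mul_le_iff₀ hr, mul_one] at this

variable [IsTopologicalAddGroup E] [ContinuousSMul 𝕜 E] [LocallyConvexSpace 𝕜 E]

/-- A form of the bipolar theorem: a closed absolutely convex set and a point outside it are
separated by a continuous functional. -/
theorem AbsConvex.exists_strongDual_norm_le_one_lt {U : Set E} (hU : AbsConvex 𝕜 U)
    (hUc : IsClosed U) (hne : U.Nonempty) {x : E} (hx : x ∉ U) :
    ∃ f : StrongDual 𝕜 E, (∀ y ∈ U, ‖f y‖ ≤ 1) ∧ 1 < ‖f x‖ := by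
  let _ : Module ℝ E := Module.compHom E (algebraMap ℝ 𝕜)
  have : IsScalarTower ℝ 𝕜 E := IsScalarTower.of_algebraMap_smul fun _ _ => rfl
  have : LocallyConvexSpace ℝ E := 
    ⟨fun z => (LocallyConvexSpace.convex_basis (𝕜 := 𝕜) z).to_hasBasis
      (fun s hs => ⟨s, ⟨hs.1, hs.2.lift ℝ⟩, le_rfl⟩) fun s hs =>
        ((LocallyConvexSpace.convex_basis (𝕜 := 𝕜) z).mem_iff.1 hs.1).imp fun t ht => ht⟩
  obtain ⟨f, c, hc, hcx⟩ := RCLike.geometric_hahn_banach_closed_point (𝕜 := 𝕜)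
    (hU.2.lift ℝ) hUc hx
  have hc0 : 0 < c := by simpa using hc 0 (hU.zero_mem_of_nonempty hne)
  have key : ∀ y ∈ U, ‖f y‖ ≤ c := by
    intro y hy
    -- Balancedness allows rotating `y` so that the bound on the real part becomes one on the norm.
    obtain ⟨a, ha, ha'⟩ := RCLike.exists_norm_eq_mul_self (f y)
    have := hc (a • y) (hU.1.smul_mem ha.le hy)
    rw [map_smul, smul_eq_mul, ← ha', RCLike.ofReal_re] at this
    exact this.le
  refine ⟨((c : 𝕜)⁻¹) • f, fun y hy => ?_, ?_⟩
  · simp only [smul_apply, norm_smul, norm_inv, RCLike.norm_ofReal,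
      abs_of_pos hc0]
    rw [inv_mul_le_iff₀ hc0, mul_one]
    exact key y hy
  · simp only [smul_apply, norm_smul, norm_inv, RCLike.norm_ofReal,
      abs_of_pos hc0]
    rw [lt_inv_mul_iff₀ hc0, mul_one]
    exact hcx.trans_le (RCLike.re_le_norm _)

theorem exists_strongDual_apply_ne_zero [T2Space E] {x : E} (hx : x ≠ 0) :
    ∃ f : StrongDual 𝕜 E, f x ≠ 0 := by
  obtain ⟨f, -, hf⟩ := AbsConvex.exists_strongDual_norm_le_one_lt (𝕜 := 𝕜) (U := ({0} : Set E))
    ⟨by simp [balanced_iff_smul_mem], convex_singleton 0⟩ isClosed_singleton ⟨0, rfl⟩ (x := x) hx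
  refine ⟨f, fun h => ?_⟩
  rw [h, norm_zero] at hf
  linarith

theorem AbsConvex.absorbs_of_forall_norm_le {U S : Set E} (hU : AbsConvex 𝕜 U)
    (hUc : IsClosed U) (hne : U.Nonempty) {r : ℝ} (hr : 0 < r)
    (h : ∀ f : StrongDual 𝕜 E, (∀ y ∈ U, ‖f y‖ ≤ 1) → ∀ x ∈ S, ‖f x‖ ≤ r) : Absorbs 𝕜 U S := by
  refine hU.1.absorbs_of_forall_inv_smul_mem hr fun x hx => ?_
  by_contra hxU
  obtain ⟨f, hf, hfx⟩ := hU.exists_strongDual_norm_le_one_lt hUc hne hxU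
  rw [map_smul, norm_smul, norm_inv, RCLike.norm_ofReal, abs_of_pos hr, lt_inv_mul_iff₀ hr,
    mul_one] at hfx
  exact hfx.not_ge (h f hf x hx)

end Bipolar

/-! ### Polars as neighbourhoods in the strong dual -/

section StrongDual

variable {𝕜 : Type} [RCLike 𝕜] {E : Type u} [AddCommGroup E] [Module 𝕜 E] [TopologicalSpace E]

theorem Bornology.IsVonNBounded.polar_mem_nhds {B : Set E} (hB : IsVonNBounded 𝕜 B) :
    {f : StrongDual 𝕜 E | ∀ x ∈ B, ‖f x‖ ≤ 1} ∈ 𝓝 (0 : StrongDual 𝕜 E) := by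
  filter_upwards [ContinuousLinearMap.eventually_nhds_zero_mapsTo (σ := RingHom.id 𝕜) hB
    (Metric.closedBall_mem_nhds (0 : 𝕜) one_pos)] with f hf x hx
  simpa using hf hx

theorem balanced_strongDual_polar (B : Set E) :
    Balanced 𝕜 {f : StrongDual 𝕜 E | ∀ x ∈ B, ‖f x‖ ≤ 1} := by
  rw [balanced_iff_smul_mem]
  intro a ha f hf x hx
  rw [smul_apply, norm_smul]
  exact mul_le_one₀ ha (norm_nonneg _) (hf x hx)

variable [ContinuousSMul 𝕜 E]

theorem hasBasis_nhds_zero_strongDual :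
    (𝓝 (0 : StrongDual 𝕜 E)).HasBasis (fun B : Set E => IsVonNBounded 𝕜 B)
      fun B => {f : StrongDual 𝕜 E | ∀ x ∈ B, ‖f x‖ ≤ 1} := by
  refine ⟨fun N => ⟨fun hN => ?_, fun ⟨B, hB, hBN⟩ => mem_of_superset hB.polar_mem_nhds hBN⟩⟩
  obtain ⟨⟨B, ε⟩, ⟨hB, hε⟩, hN⟩ := (ContinuousLinearMap.hasBasis_nhds_zero_of_basis
    (σ := RingHom.id 𝕜) (E := E) (Metric.nhds_basis_closedBall (x := (0 : 𝕜)))).mem_iff.1 hN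
  -- Scaling the bounded set absorbs the radius `ε`.
  refine ⟨((ε : 𝕜)⁻¹) • B, ?_, fun f hf => hN fun x hx => ?_⟩
  · exact hB.image (((ε : 𝕜)⁻¹) • ContinuousLinearMap.id 𝕜 E)
  · have := hf _ (smul_mem_smul_set hx)
    rwa [map_smul, norm_smul, norm_inv, RCLike.norm_ofReal, abs_of_pos hε,
      inv_mul_le_iff₀ hε, mul_one, ← mem_closedBall_zero_iff] at this

end StrongDual

/-! ### Uniform boundedness on `ℓ¹` and the Banach–Mackey theorem -/

section BanachMackey

variable {𝕜 : Type} [RCLike 𝕜]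

theorem lp_one_summable_norm (a : lp (fun _ : ℕ => 𝕜) 1) : Summable fun n => ‖a n‖ := by
  simpa using (lp.memℓp a).summable (by simp)

theorem lp_one_norm_eq_tsum (a : lp (fun _ : ℕ => 𝕜) 1) : ‖a‖ = ∑' n, ‖a n‖ := by
  simpa using lp.norm_eq_tsum_rpow (p := 1) (by simp) a

theorem summable_mul_of_norm_le {a c : ℕ → 𝕜} (ha : Summable fun n => ‖a n‖) {M : ℝ}
    (hc : ∀ n, ‖c n‖ ≤ M) : Summable fun n => a n * c n :=
  .of_norm_bounded (ha.mul_right M) fun n => by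
    rw [norm_mul]; exact mul_le_mul_of_nonneg_left (hc n) (norm_nonneg _)

/-- The functional on `ℓ¹` given by a bounded sequence. -/
noncomputable def lpOneFunctional (c : ℕ → 𝕜) {M : ℝ} (hc : ∀ n, ‖c n‖ ≤ M) :
    lp (fun _ : ℕ => 𝕜) 1 →L[𝕜] 𝕜 :=
  LinearMap.mkContinuous
    { toFun := fun a => ∑' n, a n * c n
      map_add' := fun a b => by
        rw [← (summable_mul_of_norm_le (lp_one_summable_norm a) hc).tsum_add
          (summable_mul_of_norm_le (lp_one_summable_norm b) hc)]
        exact tsum_congr fun n => add_mul _ _ _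
      map_smul' := fun r a => by
        rw [RingHom.id_apply, smul_eq_mul, ← tsum_mul_left]
        exact tsum_congr fun n => mul_assoc _ _ _ } M fun a => by
    have h := (lp_one_summable_norm a).mul_right M
    rw [lp_one_norm_eq_tsum, mul_comm, ← tsum_mul_right]
    exact tsum_of_norm_bounded h.hasSum fun n => by
      rw [norm_mul]; exact mul_le_mul_of_nonneg_left (hc n) (norm_nonneg _)

theorem lpOneFunctional_apply (c : ℕ → 𝕜) {M : ℝ} (hc : ∀ n, ‖c n‖ ≤ M)
    (a : lp (fun _ : ℕ => 𝕜) 1) : lpOneFunctional c hc a = ∑' n, a n * c n := rfl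

/-- A bounded family of bounded sequences, tested against `ℓ¹`, is uniformly bounded. -/
theorem exists_norm_le_of_forall_tsum_le {ι : Type*} (c : ι → ℕ → 𝕜)
    (hc : ∀ i, ∃ M : ℝ, ∀ n, ‖c i n‖ ≤ M)
    (h : ∀ a : ℕ → 𝕜, (Summable fun n => ‖a n‖) → ∃ r : ℝ, ∀ i, ‖∑' n, a n * c i n‖ ≤ r) :
    ∃ r : ℝ, ∀ i n, ‖c i n‖ ≤ r := by
  choose M hM using hc
  obtain ⟨r, hr⟩ := banach_steinhaus (g := fun i => lpOneFunctional (c i) (hM i))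
    fun a => h a (lp_one_summable_norm a)
  refine ⟨r, fun i n => ?_⟩
  -- Testing on unit vectors recovers the entries from the operator norm.
  have h1 := (lpOneFunctional (c i) (hM i)).le_of_opNorm_le (hr i)
    (lp.single 1 n (1 : 𝕜))
  rw [lpOneFunctional_apply, lp.norm_single (by simp), norm_one, mul_one,
    tsum_eq_single n fun m hm => by simp [hm]] at h1
  simpa using h1

variable {E : Type u} [AddCommGroup E] [Module 𝕜 E] [TopologicalSpace E]
variable [IsTopologicalAddGroup E] [ContinuousSMul 𝕜 E] [LocallyConvexSpace 𝕜 E]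

/-- A form of the Banach–Mackey theorem: if absolutely convergent combinations of elements of the
polar of a barrel `U` are continuous functionals, then `U` absorbs all weakly bounded sets. -/
theorem AbsConvex.absorbs_of_weakly_bounded {U S : Set E} (hU : AbsConvex 𝕜 U)
    (hUc : IsClosed U) (hne : U.Nonempty) (hUa : ∀ x, Absorbs 𝕜 U {x})
    (hsum : ∀ ξ : ℕ → StrongDual 𝕜 E, (∀ n, ∀ x ∈ U, ‖ξ n x‖ ≤ 1) → ∀ a : ℕ → 𝕜,
      (Summable fun n => ‖a n‖) → ∃ f : StrongDual 𝕜 E, ∀ x, f x = ∑' n, a n * ξ n x)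
    (hS : ∀ f : StrongDual 𝕜 E, ∃ r : ℝ, ∀ x ∈ S, ‖f x‖ ≤ r) : Absorbs 𝕜 U S := by
  by_contra hcon
  have h1 : ∀ n : ℕ, ∃ f : StrongDual 𝕜 E, (∀ y ∈ U, ‖f y‖ ≤ 1) ∧ ∃ x ∈ S, (n : ℝ) + 1 < ‖f x‖ := by
    intro n
    by_contra! h
    exact hcon (hU.absorbs_of_forall_norm_le hUc hne (by positivity) h)
  choose ξ hξ x hxS hx using h1
  -- Each row is bounded because `U` absorbs points; each `ℓ¹`-test is bounded because its sum is a
  -- continuous functional, hence bounded on `S`.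
  obtain ⟨r, hr⟩ := exists_norm_le_of_forall_tsum_le (fun (s : S) n => ξ n s) (fun s => by
    obtain ⟨M, hM, h⟩ := (hUa s).exists_pos_forall_inv_smul_mem
    refine ⟨M, fun n => ?_⟩
    have := hξ n _ (h s rfl)
    rwa [map_smul, norm_smul, norm_inv, RCLike.norm_ofReal, abs_of_pos hM, inv_mul_le_iff₀ hM,
      mul_one] at this) fun a ha => by
    obtain ⟨f, hf⟩ := hsum ξ hξ a ha
    obtain ⟨r, hr⟩ := hS f
    exact ⟨r, fun s => by rw [← hf]; exact hr s s.2⟩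
  obtain ⟨n, hn⟩ := exists_nat_gt r
  linarith [hr ⟨x n, hxS n⟩ n, hx n]

end BanachMackey

/-! ### Completeness of the strong dual -/

section CompleteDual

variable {𝕜 : Type} [RCLike 𝕜] {E : Type u} [AddCommGroup E] [Module 𝕜 E] [TopologicalSpace E]

variable (𝕜 E) in
/-- The evaluation map from a space into the dual of its strong dual. -/
def strongDualEval [ContinuousSMul 𝕜 E] : E →ₗ[𝕜] StrongDual 𝕜 (StrongDual 𝕜 E) where
  toFun x :=
    { toFun := fun f => f x
      map_add' := fun _ _ => rfl
      map_smul' := fun _ _ => rfl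
      cont := continuous_eval_const x }
  map_add' x y := by ext f; exact map_add f x y
  map_smul' c x := by ext f; exact map_smul f c x

theorem isCompleteTVS_iff {F : Type u} [AddCommGroup F] [UniformSpace F] [IsUniformAddGroup F] :
    IsCompleteTVS F ↔ CompleteSpace F := by
  rw [IsCompleteTVS, IsUniformAddGroup.rightUniformSpace_eq]

/-- As `U` absorbs bounded sets, the `ξ n` are uniformly bounded on each of them, so the series is
Cauchy in the strong dual; evaluations are continuous and identify its sum. -/
theorem Bornology.IsVonNBounded.exists_tsum_strongDual [ContinuousSMul 𝕜 E]
    (hE : CompleteSpace (StrongDual 𝕜 E)) {U : Set E}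
    (hU : ∀ B, IsVonNBounded 𝕜 B → Absorbs 𝕜 U B)
    (ξ : ℕ → StrongDual 𝕜 E) (hξ : ∀ n, ∀ x ∈ U, ‖ξ n x‖ ≤ 1) (a : ℕ → 𝕜)
    (ha : Summable fun n => ‖a n‖) : ∃ f : StrongDual 𝕜 E, ∀ x, f x = ∑' n, a n * ξ n x := by
  have hs : Summable fun n => a n • ξ n := by
    rw [summable_iff_vanishing]
    intro N hN
    obtain ⟨B, hB, hBN⟩ := hasBasis_nhds_zero_strongDual.mem_iff.1 hN
    obtain ⟨r, hr, h⟩ := (hU B hB).exists_pos_forall_inv_smul_mem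
    obtain ⟨s, hs⟩ := summable_iff_vanishing.1 ha (Metric.ball 0 r⁻¹)
      (Metric.ball_mem_nhds _ (by positivity))
    refine ⟨s, fun t ht => hBN fun x hx => ?_⟩
    have h1 := hs t ht
    rw [mem_ball_zero_iff, Real.norm_of_nonneg (Finset.sum_nonneg fun _ _ => norm_nonneg _)] at h1
    have h2 : ∀ n, ‖ξ n x‖ ≤ r := fun n => by
      have := hξ n _ (h x hx)
      rwa [map_smul, norm_smul, norm_inv, RCLike.norm_ofReal, abs_of_pos hr, inv_mul_le_iff₀ hr,
        mul_one] at this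
    rw [sum_apply]
    calc ‖∑ n ∈ t, (a n • ξ n) x‖ ≤ ∑ n ∈ t, ‖a n‖ * r := norm_sum_le_of_le _ fun n _ => by
          rw [smul_apply, norm_smul]; exact mul_le_mul_of_nonneg_left (h2 n) (norm_nonneg _)
      _ ≤ r⁻¹ * r := by rw [← Finset.sum_mul]; gcongr
      _ = 1 := inv_mul_cancel₀ hr.ne'
  refine ⟨∑' n, a n • ξ n, fun x => ?_⟩
  have := hs.hasSum.map (strongDualEval 𝕜 E x) (ContinuousLinearMap.continuous _)
  exact this.tsum_eq.symm

/-- If linear functionals that are continuous on bounded sets are continuous, then the strong dual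
is complete. -/
theorem completeSpace_strongDual_of_continuousOn [ContinuousSMul 𝕜 E]
    (h : ∀ f : E →ₗ[𝕜] 𝕜, (∀ B, IsVonNBounded 𝕜 B → ContinuousOn f B) → Continuous f) :
    CompleteSpace (StrongDual 𝕜 E) := by
  have hi := ContinuousLinearMap.isUniformEmbedding_toUniformOnFun (σ := RingHom.id 𝕜) (E := E)
    (F := 𝕜)
  rw [completeSpace_iff_isComplete_range hi.isUniformInducing]
  apply IsClosed.isComplete
  -- A limit is linear, being a pointwise limit, and continuous on bounded sets, being a uniform
  -- limit there.
  refine isClosed_of_closure_subset fun g hg => ?_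
  have hlin : UniformOnFun.toFun _ g ∈ range ((↑) : (E →ₗ[𝕜] 𝕜) → E → 𝕜) := by
    refine ((LinearMap.isClosed_range_coe E 𝕜 (RingHom.id 𝕜)).preimage
      (UniformOnFun.uniformContinuous_toFun
        sUnion_isVonNBounded_eq_univ).continuous).closure_subset_iff.2 ?_ hg
    rintro _ ⟨f, rfl⟩
    exact ⟨f, rfl⟩
  obtain ⟨f, hf⟩ := hlin
  have hfc : Continuous f := by
    refine h f fun B hB => ?_
    rw [hf]
    have := mem_closure_iff_nhdsWithin_neBot.1 hg
    have ht : TendstoUniformlyOn _ _ _ B := UniformOnFun.tendsto_iff_tendstoUniformlyOn.1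
      (tendsto_id.mono_left (nhdsWithin_le_nhds (a := g) (s := range
        fun f : StrongDual 𝕜 E => UniformOnFun.ofFun {s | IsVonNBounded 𝕜 s} ⇑f))) B hB
    refine ht.continuousOn (Eventually.frequently ?_)
    filter_upwards [self_mem_nhdsWithin]
    rintro _ ⟨k, rfl⟩
    exact k.continuous.continuousOn
  exact ⟨⟨f, hfc⟩, hf⟩

end CompleteDual

/-! ### Compact polars and semi-reflexivity -/

section Compactness

variable {𝕜 : Type} [RCLike 𝕜]

/-- A form of the Banach–Alaoglu theorem: polars of `0`-neighbourhoods are compact for the topology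
of pointwise convergence. -/
theorem isCompact_coe_image_polar {Z : Type u} [AddCommGroup Z] [Module 𝕜 Z] [TopologicalSpace Z]
    [IsTopologicalAddGroup Z] [ContinuousSMul 𝕜 Z] {V : Set Z} (hV : V ∈ 𝓝 (0 : Z)) :
    IsCompact ((fun (φ : StrongDual 𝕜 Z) (z : Z) => φ z) '' {φ | ∀ z ∈ V, ‖φ z‖ ≤ 1}) := by
  have habs : ∀ z : Z, ∃ r : ℝ, 0 < r ∧ ((r : 𝕜)⁻¹) • z ∈ V := fun z => by
    obtain ⟨r, hr, h⟩ := ((absorbent_nhds_zero (𝕜 := 𝕜) hV) z).exists_pos_forall_inv_smul_mem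
    exact ⟨r, hr, h z rfl⟩
  choose r hr hrV using habs
  refine (isCompact_univ_pi fun z => isCompact_closedBall (0 : 𝕜) (r z)).of_isClosed_subset
    ?_ ?_
  · have : (fun (φ : StrongDual 𝕜 Z) (z : Z) => φ z) '' {φ | ∀ z ∈ V, ‖φ z‖ ≤ 1} =
        range ((↑) : (Z →ₗ[𝕜] 𝕜) → Z → 𝕜) ∩ ⋂ z ∈ V, {g | ‖g z‖ ≤ 1} := by
      ext g
      simp only [mem_image, mem_ofPred_eq, mem_inter_iff, mem_range, mem_iInter]
      constructor
      · rintro ⟨φ, hφ, rfl⟩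
        exact ⟨⟨φ, rfl⟩, hφ⟩
      · rintro ⟨⟨f, rfl⟩, hf⟩
        refine ⟨⟨f, ?_⟩, hf, rfl⟩
        refine continuous_of_continuousAt_zero f ?_
        rw [ContinuousAt, map_zero, Metric.nhds_basis_closedBall.tendsto_right_iff]
        intro ε hε
        have hε' : (ε : 𝕜) ≠ 0 := by exact_mod_cast hε.ne'
        filter_upwards [(set_smul_mem_nhds_zero_iff hε').2 hV]
        rintro _ ⟨z, hz, rfl⟩
        rw [mem_closedBall_zero_iff, map_smul, norm_smul, RCLike.norm_ofReal, abs_of_pos hε]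
        exact mul_le_of_le_one_right hε.le (hf z hz)
    rw [this]
    exact (LinearMap.isClosed_range_coe Z 𝕜 (RingHom.id 𝕜)).inter
      (isClosed_biInter fun z _ => isClosed_le (continuous_apply z).norm continuous_const)
  · rintro _ ⟨φ, hφ, rfl⟩ z -
    have := hφ _ (hrV z)
    rwa [map_smul, norm_smul, norm_inv, RCLike.norm_ofReal, abs_of_pos (hr z),
      inv_mul_le_iff₀ (hr z), mul_one, ← mem_closedBall_zero_iff] at this

theorem isLCHausdorff_induced {X : Type u} [AddCommGroup X] [Module 𝕜 X] {ι : Type*}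
    (J : X →ₗ[𝕜] (ι → 𝕜)) (hJ : Function.Injective J) :
    IsLCHausdorff 𝕜 (TopologicalSpace.induced J inferInstance) where
  isTopologicalAddGroup := topologicalAddGroup_induced J
  continuousSMul := continuousSMul_induced J
  locallyConvexSpace := LocallyConvexSpace.induced J
  t2Space := by
    let _ : TopologicalSpace X := TopologicalSpace.induced J inferInstance
    exact T2Space.of_injective_continuous hJ continuous_induced_dom

variable {E : Type u} [AddCommGroup E] [Module 𝕜 E] [TopologicalSpace E]
variable [ContinuousSMul 𝕜 E]

/-- A space is semi-reflexive if its bounded sets lie in compact absolutely convex sets. -/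
theorem isSemiReflexive_of_exists_isCompact [T2Space E]
    (h : ∀ B : Set E, IsVonNBounded 𝕜 B → ∃ C, B ⊆ C ∧ AbsConvex 𝕜 C ∧ IsCompact C)
    (φ : StrongDual 𝕜 (StrongDual 𝕜 E)) : ∃ x : E, ∀ f : StrongDual 𝕜 E, φ f = f x := by
  obtain ⟨B, hB, hBφ⟩ := hasBasis_nhds_zero_strongDual.mem_iff.1
    (φ.continuous.continuousAt.preimage_mem_nhds (t := Metric.closedBall 0 1) (by
      rw [map_zero]; exact Metric.closedBall_mem_nhds _ one_pos))
  -- Inserting `0` keeps `C` nonempty even when `B` is empty.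
  obtain ⟨C, hBC, hC, hCc⟩ := h (insert 0 B) (hB.insert 0)
  have h0 : (0 : E) ∈ C := hBC (mem_insert _ _)
  have hφ : ∀ f : StrongDual 𝕜 E, (∀ x ∈ C, ‖f x‖ ≤ 1) → ‖φ f‖ ≤ 1 := fun f hf => by
    simpa using hBφ (show f ∈ _ from fun x hx => hf x (hBC (mem_insert_of_mem _ hx)))
  -- Helly's argument: otherwise the values of `φ` on `F` are separated from the compact image of
  -- `C`, and the separating combination of `F` violates `hφ`. Compactness of `C` then handles all
  -- functionals at once.
  have hfin : ∀ F : Finset (StrongDual 𝕜 E), ∃ x ∈ C, ∀ f ∈ F, f x = φ f := by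
    intro F
    classical
    let T : E →L[𝕜] (F → 𝕜) := ContinuousLinearMap.pi fun f => f.1
    by_contra! hcon
    have hv : (fun f : F => φ f.1) ∉ T '' C := by
      rintro ⟨x, hx, hxv⟩
      obtain ⟨f, hf, hne⟩ := hcon x hx
      exact hne (congrFun hxv ⟨f, hf⟩)
    obtain ⟨g, hg, hgv⟩ := AbsConvex.exists_strongDual_norm_le_one_lt (𝕜 := 𝕜) (U := T '' C)
      (hC.image T.toLinearMap)
      (hCc.image T.continuous).isClosed ⟨_, mem_image_of_mem T h0⟩ hv
    have hsum : ∀ w : F → 𝕜, g w = ∑ f, w f * g (Pi.single f 1) := by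
      intro w
      conv_lhs => rw [← Finset.univ_sum_single w]
      rw [map_sum]
      refine Finset.sum_congr rfl fun f _ => ?_
      rw [← smul_eq_mul, ← map_smul, ← Pi.single_smul, smul_eq_mul, mul_one]
    have hgT : g.comp T = ∑ f : F, g (Pi.single f 1) • f.1 := by
      ext x
      rw [ContinuousLinearMap.comp_apply, hsum, sum_apply]
      exact Finset.sum_congr rfl fun f _ => mul_comm _ _
    have h1 : φ (g.comp T) = g fun f : F => φ f.1 := by
      rw [hgT, map_sum, hsum]
      refine Finset.sum_congr rfl fun f _ => ?_
      rw [map_smul, smul_eq_mul, mul_comm]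
    rw [← h1] at hgv
    exact hgv.not_ge (hφ _ fun x hx => hg _ (mem_image_of_mem T hx))
  obtain ⟨x, hx⟩ := hCc.inter_iInter_nonempty (fun f : StrongDual 𝕜 E => {x | f x = φ f})
    (fun f => isClosed_eq f.continuous continuous_const) fun F => by
      obtain ⟨x, hxC, hx⟩ := hfin F
      exact ⟨x, hxC, mem_iInter₂.2 hx⟩
  exact ⟨x, fun f => (mem_iInter.1 hx.2 f).symm⟩

end Compactness

/-! ### Barrelled strong duals and biduals -/

section SemiReflexive

variable {𝕜 : Type} [RCLike 𝕜] {E : Type u} [AddCommGroup E] [Module 𝕜 E] [TopologicalSpace E]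
variable [IsTopologicalAddGroup E] [ContinuousSMul 𝕜 E] [LocallyConvexSpace 𝕜 E]

/-- A complete strong dual of a semi-reflexive space is barrelled. -/
theorem barrelledSpace_strongDual
    (hE : ∀ φ : StrongDual 𝕜 (StrongDual 𝕜 E), ∃ x : E, ∀ f : StrongDual 𝕜 E, φ f = f x)
    (hc : CompleteSpace (StrongDual 𝕜 E)) : BarrelledSpace 𝕜 (StrongDual 𝕜 E) where
  continuous_of_lowerSemicontinuous p hp := by
    have hT : {f | p f ≤ 1} = p.closedBall 0 1 := by
      ext f; rw [Seminorm.mem_closedBall_zero, mem_ofPred_eq]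
    have hTc : IsClosed {f | p f ≤ 1} := hp.isClosed_preimage 1
    have hTa : AbsConvex 𝕜 {f | p f ≤ 1} := by
      rw [hT]
      refine ⟨p.balanced_closedBall_zero 1, fun f hf g hg a b ha hb hab => ?_⟩
      obtain ⟨a, ha', rfl⟩ := RCLike.nonneg_iff_exists_ofReal.1 ha
      obtain ⟨b, hb', rfl⟩ := RCLike.nonneg_iff_exists_ofReal.1 hb
      have hab' : a + b = 1 := by exact_mod_cast hab
      rw [Seminorm.mem_closedBall_zero] at *
      calc p ((a : 𝕜) • f + (b : 𝕜) • g) ≤ p ((a : 𝕜) • f) + p ((b : 𝕜) • g) := map_add_le_add _ _ _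
        _ = a * p f + b * p g := by
          rw [map_smul_eq_mul, map_smul_eq_mul, RCLike.norm_of_nonneg ha',
            RCLike.norm_of_nonneg hb']
        _ ≤ a * 1 + b * 1 := by gcongr
        _ = 1 := by rw [mul_one, mul_one, hab']
    have hne : {f | p f ≤ 1}.Nonempty := ⟨0, by simp⟩
    -- The polar of the barrel in `E` is weakly bounded, hence bounded by Banach–Mackey; by
    -- semi-reflexivity and the bipolar theorem its own polar lies in the barrel.
    have hS : IsVonNBounded 𝕜 {x : E | ∀ f, p f ≤ 1 → ‖f x‖ ≤ 1} := by
      rw [(nhds_hasBasis_absConvex_closed 𝕜 E).isVonNBounded_iff]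
      rintro U ⟨hU, hUc, hUa⟩
      refine hUa.absorbs_of_weakly_bounded hUc ⟨0, mem_of_mem_nhds hU⟩
        (fun x => absorbent_nhds_zero hU x)
        (IsVonNBounded.exists_tsum_strongDual hc fun B hB => hB hU) fun f => ?_
      have hr : 0 < p f + 1 := by positivity
      refine ⟨p f + 1, fun x hx => ?_⟩
      have := hx (((p f + 1 : ℝ) : 𝕜)⁻¹ • f) (by
        rw [map_smul_eq_mul, norm_inv, RCLike.norm_ofReal, abs_of_pos hr, inv_mul_le_iff₀ hr]
        linarith)
      rwa [smul_apply, norm_smul, norm_inv, RCLike.norm_ofReal, abs_of_pos hr,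
        inv_mul_le_iff₀ hr, mul_one] at this
    refine Seminorm.continuous' (r := 1) ?_
    rw [← hT]
    refine mem_of_superset hS.polar_mem_nhds fun f hf => ?_
    by_contra hfT
    obtain ⟨φ, hφ, hφf⟩ := hTa.exists_strongDual_norm_le_one_lt hTc hne hfT
    obtain ⟨x, hx⟩ := hE φ
    rw [hx] at hφf
    exact hφf.not_ge (hf x fun g hg => hx g ▸ hφ g hg)

/-- A bornological space is identified with a strong dual by a linear bijection under which bounded
sets are equicontinuous and basic neighbourhoods contain polars of bounded sets. -/
theorem nonempty_equiv_strongDual {X : Type u} [AddCommGroup X] [Module 𝕜 X] [TopologicalSpace X]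
    [IsTopologicalAddGroup X] (hX : IsBornological 𝕜 X) {Z : Type u} [AddCommGroup Z] [Module 𝕜 Z]
    [TopologicalSpace Z] [ContinuousSMul 𝕜 Z] (T : X ≃ₗ[𝕜] StrongDual 𝕜 Z)
    (hB : ∀ B : Set X, IsVonNBounded 𝕜 B → {z | ∀ x ∈ B, ‖T x z‖ ≤ 1} ∈ 𝓝 (0 : Z))
    (hU : ∀ U ∈ 𝓝 (0 : X), ∃ D : Set Z, IsVonNBounded 𝕜 D ∧ ∀ x, (∀ z ∈ D, ‖T x z‖ ≤ 1) → x ∈ U) :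
    Nonempty (X ≃L[𝕜] StrongDual 𝕜 Z) := by
  refine ⟨⟨T, ?_, ?_⟩⟩
  · refine continuous_of_continuousAt_zero T ?_
    rw [ContinuousAt, map_zero, hasBasis_nhds_zero_strongDual.tendsto_right_iff]
    intro D hD
    have hac : AbsConvex 𝕜 {x : X | ∀ f ∈ D, ‖T x f‖ ≤ 1} :=
      absConvex_setOf_forall_norm_le (𝕜 := 𝕜) D
        fun z => (strongDualEval 𝕜 Z z).toLinearMap.comp T.toLinearMap
    -- Bornologicality reduces continuity to absorbing bounded sets.
    refine hX _ hac fun B hB' => ?_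
    obtain ⟨r, hr, h⟩ := (hD (hB B hB')).exists_pos_forall_inv_smul_mem
    refine hac.1.absorbs_of_forall_inv_smul_mem hr fun x hx z hz => ?_
    have := h z hz x hx
    rwa [map_smul] at this ⊢
  · refine continuous_of_continuousAt_zero T.symm ?_
    rw [ContinuousAt, map_zero, tendsto_def]
    intro U hU'
    obtain ⟨D, hD, h⟩ := hU U hU'
    filter_upwards [hD.polar_mem_nhds] with φ hφ
    exact h _ fun z hz => by rw [T.apply_symm_apply]; exact hφ z hz

variable (𝕜) in
theorem strongDualEval_injective [T2Space E] : Function.Injective (strongDualEval 𝕜 E) := by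
  intro x y hxy
  by_contra hne
  obtain ⟨f, hf⟩ := exists_strongDual_apply_ne_zero (𝕜 := 𝕜) (sub_ne_zero.2 hne)
  refine hf ?_
  rw [map_sub, sub_eq_zero]
  exact DFunLike.congr_fun hxy f

/-- A bornological space is the strong bidual of any semi-reflexive space with the same elements and
bounded sets in which it has a `0`-neighbourhood basis of closed absolutely convex sets. -/
theorem nonempty_equiv_bidual [T2Space E] {X : Type u} [AddCommGroup X] [Module 𝕜 X]
    [TopologicalSpace X] [IsTopologicalAddGroup X] (hX : IsBornological 𝕜 X) (e : X ≃ₗ[𝕜] E)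
    (he : ∀ B : Set X, IsVonNBounded 𝕜 B ↔ IsVonNBounded 𝕜 (e '' B))
    (hE : ∀ φ : StrongDual 𝕜 (StrongDual 𝕜 E), ∃ x : E, ∀ f : StrongDual 𝕜 E, φ f = f x)
    {𝒰 : Set (Set X)} (h𝒰 : (𝓝 (0 : X)).HasBasis (fun U => U ∈ 𝒰) id)
    (h𝒰' : ∀ U ∈ 𝒰, AbsConvex 𝕜 U ∧ IsClosed (e '' U)) :
    Nonempty (X ≃L[𝕜] StrongDual 𝕜 (StrongDual 𝕜 E)) := by
  have hsurj : Function.Surjective (strongDualEval 𝕜 E) := fun φ => by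
    obtain ⟨x, hx⟩ := hE φ
    exact ⟨x, by ext f; rw [hx]; rfl⟩
  refine nonempty_equiv_strongDual hX
    (e.trans (LinearEquiv.ofBijective (strongDualEval 𝕜 E)
      ⟨strongDualEval_injective 𝕜, hsurj⟩)) (fun B hB => ?_) fun V hV => ?_
  · filter_upwards [((he B).1 hB).polar_mem_nhds] with f hf x hx
    exact hf _ (mem_image_of_mem e hx)
  · obtain ⟨U, hU, hUV⟩ := h𝒰.mem_iff.1 hV
    obtain ⟨hUa, hUc⟩ := h𝒰' U hU
    refine ⟨{f : StrongDual 𝕜 E | ∀ x ∈ U, ‖f (e x)‖ ≤ 1}, ?_, fun x hx => hUV ?_⟩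
    · rw [hasBasis_nhds_zero_strongDual.isVonNBounded_iff]
      intro B hB
      have hB' : IsVonNBounded 𝕜 (e.symm '' B) := (he _).2 (by
        rwa [← image_comp, show ⇑e ∘ ⇑e.symm = id from funext e.apply_symm_apply, image_id])
      obtain ⟨r, hr, h⟩ := (hB' (h𝒰.mem_of_mem hU)).exists_pos_forall_inv_smul_mem
      refine (balanced_strongDual_polar B).absorbs_of_forall_inv_smul_mem hr fun f hf x hx => ?_
      have := hf _ (h _ (mem_image_of_mem _ hx))
      rw [map_smul, map_smul, e.apply_symm_apply] at this
      exact this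
    · by_contra hcon
      have hxe : e x ∉ e '' U := by
        rwa [e.injective.mem_set_image]
      obtain ⟨f, hf, hfx⟩ := (hUa.image e.toLinearMap).exists_strongDual_norm_le_one_lt
        (𝕜 := 𝕜) hUc ⟨_, mem_image_of_mem e (mem_of_mem_nhds (h𝒰.mem_of_mem hU))⟩ hxe
      exact hfx.not_ge (hx f fun x hx => hf _ (mem_image_of_mem e hx))

end SemiReflexive

/-! ### The topology `gammaTilde` and its bounded sets -/

section GammaTilde

variable {𝕜 : Type} [RCLike 𝕜] {E : Type u} [AddCommGroup E] [Module 𝕜 E]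

/-- Refining `gammaTilde` by the topology induced by `f` changes nothing on `τ`-bounded sets, so by
minimality it changes nothing at all. -/
theorem continuous_gammaTilde_of_continuousOn {τ τ' : TopologicalSpace E} (h' : IsLCHausdorff 𝕜 τ')
    (f : E →ₗ[𝕜] 𝕜)
    (hf : ∀ B, BoundedIn 𝕜 τ B → @ContinuousOn E 𝕜 (gammaTilde 𝕜 τ τ') _ f B) :
    @Continuous E 𝕜 (gammaTilde 𝕜 τ τ') _ f := by
  obtain ⟨⟨hγ, hagree⟩, hleast⟩ := isLeast_gammaTilde (τ := τ) h'
  rw [continuous_iff_le_induced]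
  refine (hleast (a := gammaTilde 𝕜 τ τ' ⊓ TopologicalSpace.induced f inferInstance)
    ⟨⟨?_, ?_, ?_, ?_⟩, fun B hB => ?_⟩).trans inf_le_right
  · exact topologicalAddGroup_inf hγ.isTopologicalAddGroup (topologicalAddGroup_induced f)
  · exact @continuousSMul_inf _ _ _ _ _ _ hγ.continuousSMul (continuousSMul_induced f)
  · exact hγ.locallyConvexSpace.inf (LocallyConvexSpace.induced f)
  · exact t2Space_antitone inf_le_left hγ.t2Space
  · rw [induced_inf, ← hagree B hB, inf_eq_left, induced_compose, ← continuous_iff_le_induced]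
    exact (@continuousOn_iff_continuous_domRestrict E 𝕜 (gammaTilde 𝕜 τ τ') _ f B).1 (hf B hB)

theorem isCompact_gammaTilde {τ τ' : TopologicalSpace E} (h' : IsLCHausdorff 𝕜 τ') {C : Set E}
    (hC : BoundedIn 𝕜 τ C) (hCc : @IsCompact E τ' C) : @IsCompact E (gammaTilde 𝕜 τ τ') C := by
  have h : @CompactSpace C ((gammaTilde 𝕜 τ τ').induced Subtype.val) := by
    rw [(isLeast_gammaTilde (τ := τ) h').1.2 C hC]
    exact (@isCompact_iff_compactSpace E τ' C).1 hCc
  exact (@isCompact_iff_compactSpace E (gammaTilde 𝕜 τ τ') C).2 h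

theorem IsCompact.isVonNBounded_of_isLCHausdorff {σ : TopologicalSpace E} (hσ : IsLCHausdorff 𝕜 σ)
    {C : Set E} (hC : @IsCompact E σ C) : BoundedIn 𝕜 σ C := by
  have := hσ.isTopologicalAddGroup
  have := hσ.continuousSMul
  let _ : UniformSpace E := IsTopologicalAddGroup.rightUniformSpace E
  have : IsUniformAddGroup E := isUniformAddGroup_of_addCommGroup
  exact (IsCompact.totallyBounded hC).isVonNBounded 𝕜

/-- Functionals in the polar of a `τ`-neighbourhood `U` are uniformly bounded on `τ`-bounded sets,
so their `ℓ¹`-series converge uniformly there and `hc` makes the sums continuous. Banach–Mackey then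
applies to `U`. -/
theorem boundedIn_of_isVonNBounded (τ : TopologicalSpace E) (hτ : @ContinuousSMul 𝕜 E _ _ τ)
    [TopologicalSpace E] [IsTopologicalAddGroup E] [ContinuousSMul 𝕜 E] [LocallyConvexSpace 𝕜 E]
    (hc : ∀ f : E →ₗ[𝕜] 𝕜, (∀ B, BoundedIn 𝕜 τ B → ContinuousOn f B) → Continuous f)
    {𝒰 : Set (Set E)} (h𝒰 : (@nhds E τ 0).HasBasis (fun U => U ∈ 𝒰) id)
    (h𝒰' : ∀ U ∈ 𝒰, AbsConvex 𝕜 U ∧ IsClosed U) {S : Set E} (hS : IsVonNBounded 𝕜 S) :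
    BoundedIn 𝕜 τ S := by
  intro V hV
  obtain ⟨U, hU, hUV⟩ := h𝒰.mem_iff.1 hV
  refine Absorbs.mono_left ?_ hUV
  have hUτ := h𝒰.mem_of_mem hU
  have hbound : ∀ B, BoundedIn 𝕜 τ B → ∃ r : ℝ, ∀ x ∈ B, ∀ f : E →ₗ[𝕜] 𝕜,
      (∀ y ∈ U, ‖f y‖ ≤ 1) → ‖f x‖ ≤ r := fun B hB => by
    obtain ⟨r, hr, h⟩ := (hB hUτ).exists_pos_forall_inv_smul_mem
    refine ⟨r, fun x hx f hf => ?_⟩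
    have := hf _ (h x hx)
    rwa [map_smul, norm_smul, norm_inv, RCLike.norm_ofReal, abs_of_pos hr, inv_mul_le_iff₀ hr,
      mul_one] at this
  refine (h𝒰' U hU).1.absorbs_of_weakly_bounded (h𝒰' U hU).2 ⟨0, @mem_of_mem_nhds E τ 0 _ hUτ⟩
    (fun x => @absorbent_nhds_zero 𝕜 E _ _ _ _ τ hτ hUτ x) (fun ξ hξ a ha => ?_)
    fun f => (hS.exists_norm_le f).imp fun _ => And.right
  have hsum : ∀ x, Summable fun n => a n * ξ n x := fun x => by
    obtain ⟨r, hr⟩ := hbound {x} (@isVonNBounded_singleton 𝕜 E _ _ _ τ hτ x)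
    exact summable_mul_of_norm_le ha fun n => hr x rfl (ξ n).toLinearMap (hξ n)
  let f : E →ₗ[𝕜] 𝕜 :=
    { toFun := fun x => ∑' n, a n * ξ n x
      map_add' := fun x y => by
        rw [← (hsum x).tsum_add (hsum y)]
        exact tsum_congr fun n => by rw [map_add, mul_add]
      map_smul' := fun c x => by
        rw [RingHom.id_apply, smul_eq_mul, ← tsum_mul_left]
        exact tsum_congr fun n => by rw [map_smul, smul_eq_mul, mul_left_comm] }
  refine ⟨⟨f, hc f fun B hB => ?_⟩, fun x => rfl⟩
  obtain ⟨r, hr⟩ := hbound B hB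
  refine continuousOn_tsum (u := fun n => ‖a n‖ * r)
    (fun n => (continuous_const.mul (ξ n).continuous).continuousOn) (ha.mul_right r)
    fun n x hx => ?_
  rw [norm_mul]
  exact mul_le_mul_of_nonneg_left (hr x hx (ξ n).toLinearMap (hξ n)) (norm_nonneg _)

end GammaTilde

theorem isCompact_induced_iff {X Y : Type*} [t : TopologicalSpace Y] {J : X → Y} {C : Set X} :
    @IsCompact X (t.induced J) C ↔ IsCompact (J '' C) := by
  let _ : TopologicalSpace X := t.induced J
  exact IsInducing.isCompact_iff ⟨rfl⟩

/-! ### Bipolars and the weak topology -/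

section Bipolar

variable {𝕜 : Type} [RCLike 𝕜] {E : Type u} [AddCommGroup E] [Module 𝕜 E]

variable (𝕜) in
/-- The absolute bipolar of a set in a topological vector space. -/
def bipolarSet [TopologicalSpace E] (B : Set E) : Set E :=
  {x | ∀ f ∈ {f : StrongDual 𝕜 E | ∀ y ∈ B, ‖f y‖ ≤ 1}, ‖f x‖ ≤ 1}

theorem subset_bipolarSet [TopologicalSpace E] (B : Set E) : B ⊆ bipolarSet 𝕜 B :=
  fun x hx _ hf => hf x hx

theorem absConvex_bipolarSet [TopologicalSpace E] (B : Set E) : AbsConvex 𝕜 (bipolarSet 𝕜 B) :=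
  absConvex_setOf_forall_norm_le _ fun f : StrongDual 𝕜 E => f.toLinearMap

theorem isClosed_bipolarSet [TopologicalSpace E] (B : Set E) : IsClosed (bipolarSet 𝕜 B) := by
  rw [bipolarSet, ofPred_forall]
  exact isClosed_iInter fun f => by
    rw [ofPred_forall]
    exact isClosed_iInter fun _ => isClosed_le f.continuous.norm continuous_const

theorem Bornology.IsVonNBounded.bipolarSet [TopologicalSpace E] [IsTopologicalAddGroup E]
    [ContinuousSMul 𝕜 E] [LocallyConvexSpace 𝕜 E] {B : Set E} (hB : IsVonNBounded 𝕜 B) :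
    IsVonNBounded 𝕜 (bipolarSet 𝕜 B) := by
  rw [(nhds_hasBasis_absConvex_closed 𝕜 E).isVonNBounded_iff]
  rintro U ⟨hU, hUc, hUa⟩
  obtain ⟨r, hr, h⟩ := (hB hU).exists_pos_forall_inv_smul_mem
  refine hUa.absorbs_of_forall_norm_le hUc ⟨0, mem_of_mem_nhds hU⟩ hr fun f hf x hx => ?_
  have := hx ((r : 𝕜)⁻¹ • f) fun y hy => by
    rw [smul_apply, ← map_smul]
    exact hf _ (h y hy)
  rwa [smul_apply, norm_smul, norm_inv, RCLike.norm_ofReal, abs_of_pos hr, inv_mul_le_iff₀ hr,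
    mul_one] at this

/-- The weak topology works: by semi-reflexivity the bipolar of a bounded set is a polar in the
bidual, compact by Banach–Alaoglu, and closed absolutely convex sets are weakly closed. -/
theorem exists_topology_of_isSemiReflexive (τ : TopologicalSpace E)
    [TopologicalSpace E] [IsTopologicalAddGroup E] [ContinuousSMul 𝕜 E] [LocallyConvexSpace 𝕜 E]
    [T2Space E] (hb : ∀ B : Set E, BoundedIn 𝕜 τ B ↔ IsVonNBounded 𝕜 B)
    (hE : ∀ φ : StrongDual 𝕜 (StrongDual 𝕜 E), ∃ x : E, ∀ f : StrongDual 𝕜 E, φ f = f x)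
    {𝒰 : Set (Set E)} (h𝒰 : (@nhds E τ 0).HasBasis (fun U => U ∈ 𝒰) id)
    (h𝒰' : ∀ U ∈ 𝒰, AbsConvex 𝕜 U ∧ IsClosed U) :
    ∃ τ' : TopologicalSpace E, IsLCHausdorff 𝕜 τ' ∧ BBC 𝕜 τ τ' ∧ CNC 𝕜 τ τ' := by
  let J : E →ₗ[𝕜] (StrongDual 𝕜 E → 𝕜) :=
    { toFun := fun x f => f x
      map_add' := fun x y => funext fun f => map_add f x y
      map_smul' := fun c x => funext fun f => map_smul f c x }
  have hJ : Function.Injective J := fun x y h =>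
    strongDualEval_injective 𝕜 (ContinuousLinearMap.ext fun f => congrFun h f)
  refine ⟨TopologicalSpace.induced J inferInstance, isLCHausdorff_induced J hJ, fun B hB => ?_,
    𝒰, h𝒰, fun U hU => ⟨(h𝒰' U hU).1, ?_⟩⟩
  · rw [hb] at hB
    refine ⟨bipolarSet 𝕜 B, subset_bipolarSet B, absConvex_bipolarSet B,
      (hb _).2 hB.bipolarSet, ?_⟩
    rw [isCompact_induced_iff]
    convert! isCompact_coe_image_polar (𝕜 := 𝕜) hB.polar_mem_nhds using 1
    ext g
    constructor
    · rintro ⟨x, hx, rfl⟩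
      exact ⟨strongDualEval 𝕜 E x, hx, rfl⟩
    · rintro ⟨φ, hφ, rfl⟩
      obtain ⟨x, hx⟩ := hE φ
      exact ⟨x, fun f hf => hx f ▸ hφ f hf, funext fun f => (hx f).symm⟩
  · obtain ⟨hUa, hUc⟩ := h𝒰' U hU
    have hUeq : U = J ⁻¹' ⋂ f ∈ {f : StrongDual 𝕜 E | ∀ y ∈ U, ‖f y‖ ≤ 1}, {g | ‖g f‖ ≤ 1} := by
      ext x
      simp only [mem_preimage, mem_iInter]
      refine ⟨fun hx f hf => hf x hx, fun hx => ?_⟩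
      by_contra hxU
      obtain ⟨f, hf, hfx⟩ := hUa.exists_strongDual_norm_le_one_lt hUc
        ⟨0, @mem_of_mem_nhds E τ 0 _ (h𝒰.mem_of_mem hU)⟩ hxU
      exact hfx.not_ge (hx f hf)
    rw [isClosed_induced_iff]
    exact ⟨_, isClosed_biInter fun f _ => isClosed_le (continuous_apply f).norm continuous_const,
      hUeq.symm⟩

end Bipolar

/-! ### From preduals to topologies and back -/

section Predual

variable {𝕜 : Type} [RCLike 𝕜]

theorem Bornology.IsVonNBounded.polar_mem_nhds_of_barrelledSpace {Y : Type u} [AddCommGroup Y]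
    [Module 𝕜 Y] [TopologicalSpace Y] [IsTopologicalAddGroup Y] [ContinuousSMul 𝕜 Y]
    [BarrelledSpace 𝕜 Y] {B : Set (StrongDual 𝕜 Y)} (hB : IsVonNBounded 𝕜 B) :
    {y | ∀ f ∈ B, ‖f y‖ ≤ 1} ∈ 𝓝 (0 : Y) := by
  let _ : UniformSpace Y := IsTopologicalAddGroup.rightUniformSpace Y
  have : IsUniformAddGroup Y := isUniformAddGroup_of_addCommGroup
  -- Strongly bounded families are pointwise bounded, hence equicontinuous on a barrelled space.
  have h := (norm_withSeminorms 𝕜 𝕜).banach_steinhaus (𝓕 := fun f : B => f.1) (fun _ y => by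
    obtain ⟨r, -, hr⟩ := hB.exists_norm_le (strongDualEval 𝕜 Y y)
    exact ⟨r, by rintro _ ⟨f, rfl⟩; exact hr f f.2⟩)
  filter_upwards [Metric.equicontinuousAt_iff_right.1 (h.equicontinuous 0) 1 one_pos] with y hy f hf
  have := hy ⟨f, hf⟩
  simp only [Function.comp_apply, map_zero, dist_zero_left] at this
  exact this.le

theorem HasCompleteBarrelledPredual.exists_topology {X : Type u} [AddCommGroup X] [Module 𝕜 X]
    [τ : TopologicalSpace X] (h : HasCompleteBarrelledPredual 𝕜 X) :
    ∃ τ' : TopologicalSpace X, IsLCHausdorff 𝕜 τ' ∧ BBC 𝕜 τ τ' ∧ CNC 𝕜 τ τ' := by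
  obtain ⟨Y, _, _, _, _, _, _, _, -, _, ⟨e⟩⟩ := h
  let J : X →ₗ[𝕜] (Y → 𝕜) :=
    { toFun := fun x y => e x y
      map_add' := fun x y => by rw [map_add]; rfl
      map_smul' := fun c x => by rw [map_smul]; rfl }
  have hJ : Function.Injective J := fun x y h =>
    e.injective (ContinuousLinearMap.ext fun f => congrFun h f)
  have hac : ∀ D : Set Y, AbsConvex 𝕜 {x | ∀ z ∈ D, ‖e x z‖ ≤ 1} := fun D =>
    absConvex_setOf_forall_norm_le D fun z => (LinearMap.proj z).comp J
  have hbasis : (𝓝 (0 : X)).HasBasis (fun D : Set Y => IsVonNBounded 𝕜 D)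
      fun D => {x | ∀ z ∈ D, ‖e x z‖ ≤ 1} := by
    rw [e.toHomeomorph.isInducing.nhds_eq_comap]
    have := (hasBasis_nhds_zero_strongDual (𝕜 := 𝕜) (E := Y)).comap e
    rwa [← map_zero e] at this
  refine ⟨TopologicalSpace.induced J inferInstance, isLCHausdorff_induced J hJ, fun B hB => ?_,
    {U | ∃ D : Set Y, IsVonNBounded 𝕜 D ∧ {x | ∀ z ∈ D, ‖e x z‖ ≤ 1} = U}, ?_, ?_⟩
  · have hV := (hB.image e.toContinuousLinearMap).polar_mem_nhds_of_barrelledSpace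
    set V : Set Y := {y | ∀ f ∈ e.toContinuousLinearMap '' B, ‖f y‖ ≤ 1}
    refine ⟨{x | ∀ z ∈ V, ‖e x z‖ ≤ 1}, fun x hx z hz => hz _ (mem_image_of_mem _ hx), hac V,
      ?_, ?_⟩
    · rw [BoundedIn, hbasis.isVonNBounded_iff]
      intro D hD
      obtain ⟨r, hr, h⟩ := (hD hV).exists_pos_forall_inv_smul_mem
      refine (hac D).1.absorbs_of_forall_inv_smul_mem hr fun x hx z hz => ?_
      have := hx _ (h z hz)
      rwa [map_smul] at this ⊢
    · rw [isCompact_induced_iff]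
      convert! isCompact_coe_image_polar (𝕜 := 𝕜) hV using 1
      ext g
      constructor
      · rintro ⟨x, hx, rfl⟩
        exact ⟨e x, hx, rfl⟩
      · rintro ⟨φ, hφ, rfl⟩
        refine ⟨e.symm φ, fun z hz => ?_, ?_⟩
        · rw [e.apply_symm_apply]; exact hφ z hz
        · change (fun y => e (e.symm φ) y) = _
          rw [e.apply_symm_apply]
  · refine hbasis.to_hasBasis (fun D hD => ⟨_, ⟨D, hD, rfl⟩, le_rfl⟩) ?_
    rintro _ ⟨D, hD, rfl⟩
    exact ⟨D, hD, le_rfl⟩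
  · rintro _ ⟨D, hD, rfl⟩
    refine ⟨hac D, ?_⟩
    rw [isClosed_induced_iff]
    refine ⟨⋂ z ∈ D, {g | ‖g z‖ ≤ 1}, isClosed_biInter fun f _ =>
      isClosed_le (continuous_apply f).norm continuous_const, ?_⟩
    ext x
    simp only [mem_preimage, mem_iInter]
    rfl

theorem HasSemiMontelPrebidual.hasCompleteBarrelledPredual {X : Type u} [AddCommGroup X]
    [Module 𝕜 X] [TopologicalSpace X] (h : HasSemiMontelPrebidual 𝕜 X) :
    HasCompleteBarrelledPredual 𝕜 X := by
  obtain ⟨Y, _, _, _, _, _, _, _, _, hc, he⟩ := h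
  refine ⟨StrongDual 𝕜 Y, inferInstance, inferInstance, inferInstance, inferInstance,
    inferInstance, inferInstance, inferInstance, hc, ?_, he⟩
  refine barrelledSpace_strongDual (isSemiReflexive_of_exists_isCompact fun B hB =>
    ⟨bipolarSet 𝕜 B, subset_bipolarSet B, absConvex_bipolarSet B, ?_⟩) (isCompleteTVS_iff.1 hc)
  exact MontelSpace.isCompact_of_isClosed_of_isVonNBounded 𝕜 (isClosed_bipolarSet B) hB.bipolarSet

theorem hasSemiMontelPrebidual_of_sameBounded {X E : Type u} [AddCommGroup X] [Module 𝕜 X]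
    [TopologicalSpace X] [IsTopologicalAddGroup X] (hX : IsBornological 𝕜 X) [AddCommGroup E]
    [Module 𝕜 E] [TopologicalSpace E] [IsTopologicalAddGroup E] [ContinuousSMul 𝕜 E]
    [LocallyConvexSpace 𝕜 E] [T2Space E] (e : X ≃ₗ[𝕜] E)
    (he : ∀ B : Set X, IsVonNBounded 𝕜 B ↔ IsVonNBounded 𝕜 (e '' B))
    (hc : ∀ f : E →ₗ[𝕜] 𝕜, (∀ B, IsVonNBounded 𝕜 B → ContinuousOn f B) → Continuous f)
    (hK : ∀ B : Set E, IsVonNBounded 𝕜 B → ∃ C, B ⊆ C ∧ AbsConvex 𝕜 C ∧ IsCompact C)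
    {𝒰 : Set (Set X)} (h𝒰 : (𝓝 (0 : X)).HasBasis (fun U => U ∈ 𝒰) id)
    (h𝒰' : ∀ U ∈ 𝒰, AbsConvex 𝕜 U ∧ IsClosed (e '' U)) : HasSemiMontelPrebidual 𝕜 X := by
  refine ⟨E, inferInstance, inferInstance, inferInstance, inferInstance, inferInstance,
    inferInstance, inferInstance, ⟨fun B hBc hB => ?_⟩,
    isCompleteTVS_iff.2 (completeSpace_strongDual_of_continuousOn hc),
    nonempty_equiv_bidual hX e he (isSemiReflexive_of_exists_isCompact hK) h𝒰 h𝒰'⟩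
  obtain ⟨C, hBC, -, hC⟩ := hK B hB
  exact hC.of_isClosed_subset hBc hBC

end Predual

/-! ### The equivalences -/

section Main

variable {𝕜 : Type} [RCLike 𝕜] {X : Type u} [AddCommGroup X] [Module 𝕜 X]
  {τ τ' : TopologicalSpace X}

theorem CNC.gammaTilde (h' : IsLCHausdorff 𝕜 τ') (h : CNC 𝕜 τ τ') :
    CNC 𝕜 τ (gammaTilde 𝕜 τ τ') := by
  obtain ⟨𝒰, h𝒰, h𝒰'⟩ := h
  refine ⟨𝒰, h𝒰, fun U hU => ⟨(h𝒰' U hU).1, (h𝒰' U hU).2.mono ?_⟩⟩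
  -- `τ'` agrees with itself, so `gammaTilde` is finer and has more closed sets.
  exact (isLeast_gammaTilde (τ := τ) h').2 ⟨h', fun _ _ => rfl⟩

theorem BBC.gammaTilde (h' : IsLCHausdorff 𝕜 τ') (h : BBC 𝕜 τ τ') :
    BBC 𝕜 τ (gammaTilde 𝕜 τ τ') := fun B hB => by
  obtain ⟨C, hBC, hC, hCb, hCc⟩ := h B hB
  exact ⟨C, hBC, hC, hCb, isCompact_gammaTilde h' hCb hCc⟩

theorem BBC.bbcl (h' : IsLCHausdorff 𝕜 τ') (h : BBC 𝕜 τ τ') : BBCl 𝕜 τ τ' := fun B hB => by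
  obtain ⟨C, hBC, hC, hCb, hCc⟩ := h B hB
  exact ⟨C, hBC, hC, hCb, @IsCompact.isClosed X τ' h'.t2Space C hCc⟩

theorem sameBounded_gammaTilde (hτ : @ContinuousSMul 𝕜 X _ _ τ) (h' : IsLCHausdorff 𝕜 τ')
    (hB : BBC 𝕜 τ τ') (hC : CNC 𝕜 τ τ') : SameBounded 𝕜 τ (gammaTilde 𝕜 τ τ') := by
  have hγ := (isLeast_gammaTilde (τ := τ) h').1.1
  refine fun B => ⟨fun h => ?_, fun h => ?_⟩
  · obtain ⟨C, hBC, -, -, hCc⟩ := hB.gammaTilde h' B h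
    exact fun V hV => (IsCompact.isVonNBounded_of_isLCHausdorff hγ hCc hV).mono_right hBC
  · obtain ⟨𝒰, h𝒰, h𝒰'⟩ := hC.gammaTilde h'
    exact @boundedIn_of_isVonNBounded 𝕜 _ X _ _ τ hτ (gammaTilde 𝕜 τ τ') hγ.isTopologicalAddGroup
      hγ.continuousSMul hγ.locallyConvexSpace (continuous_gammaTilde_of_continuousOn h') 𝒰 h𝒰 h𝒰' B h

theorem exists_isCompact_gammaTilde (h' : IsLCHausdorff 𝕜 τ') (hB : BBC 𝕜 τ τ')
    (hS : SameBounded 𝕜 τ (gammaTilde 𝕜 τ τ')) (B : Set X)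
    (h : BoundedIn 𝕜 (gammaTilde 𝕜 τ τ') B) :
    ∃ C, B ⊆ C ∧ AbsConvex 𝕜 C ∧ @IsCompact X (gammaTilde 𝕜 τ τ') C := by
  obtain ⟨C, hBC, hC, -, hCc⟩ := hB.gammaTilde h' B ((hS B).2 h)
  exact ⟨C, hBC, hC, hCc⟩

theorem isSemiReflexive_gammaTilde (h' : IsLCHausdorff 𝕜 τ') (hB : BBC 𝕜 τ τ')
    (hS : SameBounded 𝕜 τ (gammaTilde 𝕜 τ τ')) : IsSemiReflexive 𝕜 (gammaTilde 𝕜 τ τ') := by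
  have hγ := (isLeast_gammaTilde (τ := τ) h').1.1
  exact @isSemiReflexive_of_exists_isCompact 𝕜 _ X _ _ (gammaTilde 𝕜 τ τ') hγ.continuousSMul
    hγ.t2Space (exists_isCompact_gammaTilde h' hB hS)

theorem hasSemiMontelPrebidual_of_bbc [τ : TopologicalSpace X] [IsTopologicalAddGroup X]
    (hX : IsBornological 𝕜 X) (h' : IsLCHausdorff 𝕜 τ') (hB : BBC 𝕜 τ τ') (hC : CNC 𝕜 τ τ')
    (hS : SameBounded 𝕜 τ (gammaTilde 𝕜 τ τ')) : HasSemiMontelPrebidual 𝕜 X := by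
  have hγ := (isLeast_gammaTilde (τ := τ) h').1.1
  obtain ⟨𝒰, h𝒰, h𝒰'⟩ := hC.gammaTilde h'
  refine @hasSemiMontelPrebidual_of_sameBounded 𝕜 _ X X _ _ τ _ hX _ _ (gammaTilde 𝕜 τ τ')
    hγ.isTopologicalAddGroup hγ.continuousSMul hγ.locallyConvexSpace hγ.t2Space
    (LinearEquiv.refl 𝕜 X) (fun B => ?_)
    (fun f hf => continuous_gammaTilde_of_continuousOn h' f fun B hB => hf B ((hS B).1 hB))
    (exists_isCompact_gammaTilde h' hB hS) 𝒰 h𝒰 fun U hU => ?_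
  · rw [show ⇑(LinearEquiv.refl 𝕜 X) = id from rfl, image_id]
    exact hS B
  · rw [show ⇑(LinearEquiv.refl 𝕜 X) = id from rfl, image_id]
    exact h𝒰' U hU

end Main

theorem mainTheorem1 {𝕜 : Type} [RCLike 𝕜] {X : Type u} [AddCommGroup X] [Module 𝕜 X]
    [τ : TopologicalSpace X] [IsTopologicalAddGroup X] [ContinuousSMul 𝕜 X]
    [LocallyConvexSpace 𝕜 X] [T2Space X] (hX : IsBornological 𝕜 X) :
    List.TFAE [
      HasCompleteBarrelledPredual 𝕜 X,
      HasSemiMontelPrebidual 𝕜 X,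
      ∃ τ' : TopologicalSpace X, IsLCHausdorff 𝕜 τ' ∧ BBC 𝕜 τ τ' ∧ CNC 𝕜 τ τ' ∧
        SameBounded 𝕜 τ (gammaTilde 𝕜 τ τ'),
      ∃ τ' : TopologicalSpace X, IsLCHausdorff 𝕜 τ' ∧ BBCl 𝕜 τ τ' ∧ CNC 𝕜 τ τ' ∧
        IsSemiReflexive 𝕜 (gammaTilde 𝕜 τ τ') ∧
        SameBounded 𝕜 τ (gammaTilde 𝕜 τ τ'),
      ∃ τ' : TopologicalSpace X, IsLCHausdorff 𝕜 τ' ∧ BBC 𝕜 τ τ' ∧ CNC 𝕜 τ τ'] := by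
  have hτ : ContinuousSMul 𝕜 X := inferInstance
  tfae_have 1 → 5 := HasCompleteBarrelledPredual.exists_topology
  tfae_have 2 → 1 := HasSemiMontelPrebidual.hasCompleteBarrelledPredual
  tfae_have 5 → 3 := fun ⟨τ', h', hB, hC⟩ =>
    ⟨τ', h', hB, hC, sameBounded_gammaTilde hτ h' hB hC⟩
  tfae_have 3 → 2 := fun ⟨τ', h', hB, hC, hS⟩ =>
    hasSemiMontelPrebidual_of_bbc (τ := τ) hX h' hB hC hS
  tfae_have 3 → 4 := fun ⟨τ', h', hB, hC, hS⟩ =>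
    ⟨τ', h', hB.bbcl h', hC, isSemiReflexive_gammaTilde h' hB hS, hS⟩
  tfae_have 4 → 5 := fun ⟨τ', h', _, hC, hR, hS⟩ => by
    have hγ := (isLeast_gammaTilde (τ := τ) h').1.1
    obtain ⟨𝒰, h𝒰, h𝒰'⟩ := hC.gammaTilde h'
    exact @exists_topology_of_isSemiReflexive 𝕜 _ X _ _ τ (gammaTilde 𝕜 τ τ')
      hγ.isTopologicalAddGroup hγ.continuousSMul hγ.locallyConvexSpace hγ.t2Space hS hR 𝒰 h𝒰 h𝒰'
  tfae_finish
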